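/- Let $P$ be a complex polynomial of degree $n$ having all its zeros in $|z|\le k$, where $0<k\le 1$. Put $m=\min_{|z|=k}|P(z)|$, and for $\alpha\in\mathbb{C}$ let $D_\alpha P(z)=nP(z)+(\alpha-z)P'(z)$ be the polar derivative of $P$ with respect to $\alpha$. Then for all $\alpha,\beta\in\mathbb{C}$ with $|\alpha|\ge k$ and $|\beta|\le 1$, and for every real $p>0$, $$ n(|\alpha|-k)\left(\int_0^{2\pi}\left|P(e^{i\theta})+\frac{m\beta}{k^{n-1}}\right|^p d\theta\right)^{1/p} \le \left(\int_0^{2\pi}\left|1+ke^{i\theta}\right|^p d\theta\right)^{1/p} \left(\max_{|z|=1}|D_\alpha P(z)|-\frac{nm}{k^{n-1}}\right). $$ -/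

import Mathlib

noncomputable section

/-- The polar derivative `D_α P(z) = n P(z) + (α - z) P'(z)` of a polynomial `P` of degree `n`
with respect to the point `α`. -/
def polarDeriv (α : ℂ) (P : Polynomial ℂ) : Polynomial ℂ :=
  Polynomial.C (P.natDegree : ℂ) * P +
    (Polynomial.C α - Polynomial.X) * Polynomial.derivative P

/-- `min_{|z| = r} |P(z)|`. -/
def minModulus (P : Polynomial ℂ) (r : ℝ) : ℝ :=
  sInf ((fun z : ℂ => ‖P.eval z‖) '' Metric.sphere (0 : ℂ) r)

/-- `max_{|z| = r} |P(z)|`. -/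
def maxModulus (P : Polynomial ℂ) (r : ℝ) : ℝ :=
  sSup ((fun z : ℂ => ‖P.eval z‖) '' Metric.sphere (0 : ℂ) r)

/-- `(∫_0^{2π} |f(e^{iθ})|^p dθ)^{1/p}`. -/
def circleLpNorm (p : ℝ) (f : ℂ → ℂ) : ℝ :=
  (∫ θ in (0 : ℝ)..(2 * Real.pi), ‖f (Complex.exp (θ * Complex.I))‖ ^ p) ^ (1 / p)

/-- The infimum defining `minModulus` is an attained minimum. -/
theorem isLeast_minModulus (P : Polynomial ℂ) {r : ℝ} (hr : 0 ≤ r) :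
    IsLeast ((fun z : ℂ => ‖P.eval z‖) '' Metric.sphere (0 : ℂ) r) (minModulus P r) :=
  ((isCompact_sphere (0 : ℂ) r).image P.continuous.norm).isLeast_sInf
    ((NormedSpace.sphere_nonempty.2 hr).image _)

/-- The supremum defining `maxModulus` is an attained maximum. -/
theorem isGreatest_maxModulus (P : Polynomial ℂ) {r : ℝ} (hr : 0 ≤ r) :
    IsGreatest ((fun z : ℂ => ‖P.eval z‖) '' Metric.sphere (0 : ℂ) r) (maxModulus P r) :=
  ((isCompact_sphere (0 : ℂ) r).image P.continuous.norm).isGreatest_sSup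
    ((NormedSpace.sphere_nonempty.2 hr).image _)

end

/-! For n ≥ 1 everything rests on |nP - zP'| + nm/k^(n-1) ≤ k|P'| for |z| ≥ 1
(`norm_natDegree_mul_sub_add_le_of_one_le`). As D_αP = αP' + (nP - zP'), it gives (|α| - k)|P'| ≤ X
:= max|D_αP| - nm/k^(n-1) on |z| = 1. With c = mβ/k^(n-1) it also gives n(P + c) = zP' + A, where
|A| ≤ k|P'|. Reversing coefficients carries |z| ≥ 1 into the unit disc and turns this into G = B(1 +
kzψ), with B zero-free in |z| < 1, (|α| - k)|B| ≤ X and |ψ| ≤ 1. Littlewood subordination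
(`integral_rpow_norm_one_add_le`) then bounds the p-th mean of 1 + kzψ by that of 1 + kz.

For the estimate itself: when |w| ≤ k < |z| the points 1/(z - w) lie in one fixed disc, so P'/P lies
in n times that disc, which says |nP - zP'| ≤ k|P'|. The term in m comes from applying this to F = P
+ λ(m/k^n)z^n with |λ| < 1. Its zeros stay in |z| ≤ k, nF - zF' does not see z^n, and the argument
of λ is free to shrink |F'|. -/

/-! ### Littlewood subordination on the unit circle. -/

open Complex Metric Filter Topology in
/-- Mean value property on the unit circle, for functions vanishing at the centre. -/
theorem intervalIntegral_exp_mul_eq_zero {h : ℂ → ℂ} (hh : DiffContOnCl ℂ h (ball 0 1)) :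
    ∫ θ in (0 : ℝ)..(2 * Real.pi), exp (θ * I) * h (exp (θ * I)) = 0 := by
  have h1 : DiffContOnCl ℂ (fun z => z * h z) (ball 0 |(1 : ℝ)|) := by
    rw [abs_one]
    exact (differentiable_id.diffContOnCl).smul hh
  have h2 := h1.circleAverage
  rw [Real.circleAverage_def] at h2
  simpa [circleMap, Real.pi_ne_zero] using h2

open Complex Metric in
theorem continuous_comp_exp {h : ℂ → ℂ} (hh : ContinuousOn h (closedBall 0 1)) :
    Continuous fun θ : ℝ => h (exp (θ * I)) :=
  hh.comp_continuous (by fun_prop) fun θ => by simp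

open Complex Metric in
theorem DiffContOnCl.continuousOn_closedUnitBall {h : ℂ → ℂ} (hh : DiffContOnCl ℂ h (ball 0 1)) :
    ContinuousOn h (closedBall 0 1) := by
  simpa [closure_ball (0 : ℂ) one_ne_zero] using hh.continuousOn

-- The cross term is the real part of a multiple of the integral of z h(z), which vanishes by the
-- mean value property.
open Complex Metric in
theorem integral_norm_sq_const_add {h : ℂ → ℂ} (hh : DiffContOnCl ℂ h (ball 0 1)) (a : ℂ) :
    ∫ θ in (0 : ℝ)..(2 * Real.pi), ‖a + exp (θ * I) * h (exp (θ * I))‖ ^ 2 =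
      2 * Real.pi * ‖a‖ ^ 2 + ∫ θ in (0 : ℝ)..(2 * Real.pi), ‖h (exp (θ * I))‖ ^ 2 := by
  have hc := continuous_comp_exp hh.continuousOn_closedUnitBall
  have key : ∀ θ : ℝ, ‖a + exp (θ * I) * h (exp (θ * I))‖ ^ 2 =
      (‖a‖ ^ 2 + ‖h (exp (θ * I))‖ ^ 2) +
        reCLM (2 * (starRingEnd ℂ) a * (exp (θ * I) * h (exp (θ * I)))) := by
    intro θ
    have h1 : ‖exp (θ * I) * h (exp (θ * I))‖ = ‖h (exp (θ * I))‖ := by simp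
    rw [← h1]
    generalize exp (θ * I) * h (exp (θ * I)) = b
    simp only [← normSq_eq_norm_sq, normSq_apply, reCLM_apply]
    simp
    ring
  have hi : Continuous fun θ : ℝ =>
      2 * (starRingEnd ℂ) a * (exp (θ * I) * h (exp (θ * I))) :=
    continuous_const.mul ((by fun_prop : Continuous fun θ : ℝ => exp (θ * I)).mul hc)
  have hr : Continuous fun θ : ℝ =>
      reCLM (2 * (starRingEnd ℂ) a * (exp (θ * I) * h (exp (θ * I)))) :=
    reCLM.continuous.comp hi
  have hz : ∫ θ in (0 : ℝ)..(2 * Real.pi),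
      reCLM (2 * (starRingEnd ℂ) a * (exp (θ * I) * h (exp (θ * I)))) = 0 := by
    rw [ContinuousLinearMap.intervalIntegral_comp_comm _ (hi.intervalIntegrable _ _),
      intervalIntegral.integral_const_mul, intervalIntegral_exp_mul_eq_zero hh]
    simp
  have hn : Continuous fun θ : ℝ => ‖h (exp (θ * I))‖ ^ 2 := hc.norm.pow 2
  have hn' : Continuous fun θ : ℝ => ‖a‖ ^ 2 + ‖h (exp (θ * I))‖ ^ 2 := continuous_const.add hn
  simp_rw [key]
  rw [intervalIntegral.integral_add (hn'.intervalIntegrable _ _)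
      (hr.intervalIntegrable _ _), hz,
    intervalIntegral.integral_add (continuous_const.intervalIntegrable _ _)
      (hn.intervalIntegrable _ _)]
  simp

open Complex Metric in
/-- Littlewood's subordination principle in `L²`, for polynomials. -/
theorem integral_norm_sq_eval_le {ψ : ℂ → ℂ} (hψ : DiffContOnCl ℂ ψ (ball 0 1))
    (hb : ∀ z, ‖z‖ = 1 → ‖ψ z‖ ≤ 1) (q : Polynomial ℂ) :
    ∫ θ in (0 : ℝ)..(2 * Real.pi), ‖q.eval (exp (θ * I) * ψ (exp (θ * I)))‖ ^ 2 ≤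
      ∫ θ in (0 : ℝ)..(2 * Real.pi), ‖q.eval (exp (θ * I))‖ ^ 2 := by
  induction hN : q.natDegree generalizing q with
  | zero =>
    obtain ⟨a, rfl⟩ := Polynomial.natDegree_eq_zero.1 hN
    simp
  | succ N ih =>
    have ih := ih q.divX (by rw [Polynomial.natDegree_divX_eq_natDegree_tsub_one, hN]; rfl)
    set a := q.coeff 0
    set f := q.divX with hf
    -- With q(zψ) = a + zψ f(zψ), orthogonality isolates a on both sides; |ψ| ≤ 1 then removes the
    -- factor ψ and leaves the induction hypothesis for f.
    have hq : ∀ z, q.eval z = a + z * f.eval z := fun z => by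
      conv_lhs => rw [← Polynomial.divX_mul_X_add q]
      simp [a, f]
      ring
    have hψ1 : DiffContOnCl ℂ (fun z => ψ z * f.eval (z * ψ z)) (ball 0 1) :=
      hψ.smul (f.differentiable.comp_diffContOnCl (differentiable_id.diffContOnCl.smul hψ))
    have hψc := continuous_comp_exp hψ.continuousOn_closedUnitBall
    have hu : Continuous fun θ : ℝ => f.eval (exp (θ * I) * ψ (exp (θ * I))) :=
      f.continuous.comp ((by fun_prop : Continuous fun θ : ℝ => exp (θ * I)).mul hψc)
    have e1 := integral_norm_sq_const_add hψ1 a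
    have e2 := integral_norm_sq_const_add (f.differentiable.diffContOnCl (s := ball 0 1)) a
    simp only [hq]
    rw [e2]
    simp only [mul_assoc] at e1 ⊢
    rw [e1]
    gcongr
    refine le_trans ?_ ih
    refine intervalIntegral.integral_mono_on Real.two_pi_pos.le
      (((hψc.mul hu).norm.pow 2).intervalIntegrable _ _) ((hu.norm.pow 2).intervalIntegrable _ _)
      fun θ _ => ?_
    gcongr
    rw [norm_mul]
    exact mul_le_of_le_one_left (norm_nonneg _) (hb _ (by simp))

open Complex Metric Filter Topology in
/-- Littlewood's subordination principle in `Lᵖ`, for `z ↦ 1 + s z`. -/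
theorem integral_rpow_norm_one_add_le {ψ : ℂ → ℂ} (hψ : DiffContOnCl ℂ ψ (ball 0 1))
    (hb : ∀ z, ‖z‖ = 1 → ‖ψ z‖ ≤ 1) {s : ℝ} (hs0 : 0 ≤ s) (hs1 : s < 1) {p : ℝ} (hp : 0 < p) :
    ∫ θ in (0 : ℝ)..(2 * Real.pi), ‖1 + s * (exp (θ * I) * ψ (exp (θ * I)))‖ ^ p ≤
      ∫ θ in (0 : ℝ)..(2 * Real.pi), ‖1 + s * exp (θ * I)‖ ^ p := by
  have hψc := continuous_comp_exp hψ.continuousOn_closedUnitBall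
  lift s to NNReal using hs0
  -- |1 + w|^p is the square of |(1 + w)^(p/2)|, whose binomial partial sums are polynomials, so the
  -- L² case applies to them. The radius (s + 1)/2 gives uniform convergence on an open ball
  -- containing |w| ≤ s.
  have hU := (one_add_cpow_hasFPowerSeriesOnBall_zero (a := ((p / 2 : ℝ) : ℂ))).tendstoUniformlyOn
    (r' := (s + 1) / 2) (by
      rw [← ENNReal.coe_one, ENNReal.coe_lt_coe]
      have : s < 1 := by exact_mod_cast hs1
      rw [← NNReal.coe_lt_coe]; push_cast
      linarith)
  simp only [zero_add] at hU
  set T := binomialSeries ℂ ((p / 2 : ℝ) : ℂ)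
  have hpow : ∀ z : ℂ, ‖z‖ ≤ s → ‖(1 + z) ^ ((p / 2 : ℝ) : ℂ)‖ ^ 2 = ‖1 + z‖ ^ p := by
    intro z hz
    have h0 : 1 + z ≠ 0 := by
      intro h
      have : z = -1 := by linear_combination h
      rw [this] at hz
      simp at hz
      linarith
    rw [norm_cpow_real, ← Real.rpow_natCast, ← Real.rpow_mul (norm_nonneg _)]
    congr 1
    push_cast
    ring
  have hlim : ∀ g : ℝ → ℂ, Continuous g → (∀ θ, ‖g θ‖ ≤ s) →
      Tendsto (fun N => ∫ θ in (0 : ℝ)..(2 * Real.pi), ‖T.partialSum N (g θ)‖ ^ 2) atTop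
        (𝓝 (∫ θ in (0 : ℝ)..(2 * Real.pi), ‖1 + g θ‖ ^ p)) := by
    intro g hg hgs
    have hgU := hU.comp g
    have hbd : ∀ᶠ N in atTop, ∀ θ, ‖T.partialSum N (g θ)‖ ≤ 2 ^ (p / 2) + 1 := by
      filter_upwards [Metric.tendstoUniformlyOn_iff.1 hgU 1 one_pos] with N hN θ
      have h1 := hN θ (by
        have := hgs θ
        simp
        linarith)
      have h2 : ‖(1 + g θ) ^ ((p / 2 : ℝ) : ℂ)‖ ≤ 2 ^ (p / 2) := by
        rw [norm_cpow_real]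
        have := norm_add_le 1 (g θ)
        have := hgs θ
        rw [norm_one] at *
        exact Real.rpow_le_rpow (norm_nonneg _) (by linarith) (by positivity)
      rw [dist_comm, dist_eq_norm] at h1
      have h3 := norm_sub_norm_le (T.partialSum N (g θ)) ((1 + g θ) ^ ((p / 2 : ℝ) : ℂ))
      simp only [Function.comp] at h1
      linarith
    refine intervalIntegral.tendsto_integral_filter_of_dominated_convergence
      (fun _ => (2 ^ (p / 2) + 1) ^ 2) ?_ ?_ intervalIntegrable_const ?_
    · exact .of_forall fun N =>
        (((T.partialSum_continuous N).comp hg).norm.pow 2).aestronglyMeasurable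
    · filter_upwards [hbd] with N hN
      refine .of_forall fun θ _ => ?_
      rw [norm_pow, norm_norm]
      exact pow_le_pow_left₀ (norm_nonneg _) (hN θ) 2
    · refine .of_forall fun θ _ => ?_
      rw [← hpow _ (hgs θ)]
      refine ((hgU.tendsto_at ?_).norm.pow 2)
      have := hgs θ
      simp
      linarith
  have hpoly : ∀ N, ∃ q : Polynomial ℂ, ∀ z, T.partialSum N (s * z) = q.eval z := by
    intro N
    refine ⟨∑ i ∈ Finset.range N, Polynomial.C (T.coeff i * s ^ i) * Polynomial.X ^ i, fun z => ?_⟩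
    rw [FormalMultilinearSeries.partialSum, Polynomial.eval_finsetSum]
    refine Finset.sum_congr rfl fun i _ => ?_
    simp
    ring
  have hs : ‖(s : ℂ)‖ = s := by simp
  have he : Continuous fun θ : ℝ => exp (θ * I) := by fun_prop
  refine le_of_tendsto_of_tendsto'
    (hlim _ (continuous_const.mul (he.mul hψc)) fun θ => ?_)
    (hlim _ (continuous_const.mul he) fun θ => by simp) fun N => ?_
  · rw [norm_mul, norm_mul, hs, norm_exp_ofReal_mul_I, one_mul]
    exact mul_le_of_le_one_right s.2 (hb _ (by simp))
  · obtain ⟨q, hq⟩ := hpoly N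
    simpa only [hq] using integral_norm_sq_eval_le hψ hb q

/-! ### Reversed polynomials and the disc containing P'/P. -/

theorem Polynomial.eval_reflect {N : ℕ} {f : Polynomial ℂ} (hf : f.natDegree ≤ N) {z : ℂ}
    (hz : z ≠ 0) : (f.reflect N).eval z = z ^ N * f.eval z⁻¹ := by
  let _ : Invertible z⁻¹ := invertibleOfNonzero (inv_ne_zero hz)
  have h := eval₂_reflect_mul_pow (RingHom.id ℂ) z⁻¹ N f hf
  rw [invOf_eq_inv, inv_inv] at h
  rw [Polynomial.eval, Polynomial.eval, ← h, mul_comm, mul_assoc, ← mul_pow, inv_mul_cancel₀ hz,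
    one_pow, mul_one]

-- An Apollonius disc in `v`: the difference of squares on the right is |z|² - k² > 0 times the one
-- on the left. It serves with t = 1 for a single root and t = n for the sum over all roots.
open ComplexConjugate in
theorem norm_sub_mul_le_iff {z v : ℂ} {t k : ℝ} (hk : 0 ≤ k) (ht : 0 ≤ t) (hz : k < ‖z‖) :
    ‖(t : ℂ) - z * v‖ ≤ k * ‖v‖ ↔
      ‖((‖z‖ ^ 2 - k ^ 2 : ℝ) : ℂ) * v - t * conj z‖ ≤ t * k := by
  have hq : 0 < ‖z‖ ^ 2 - k ^ 2 := by nlinarith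
  rw [← sq_le_sq₀ (norm_nonneg _) (by positivity), ← sq_le_sq₀ (norm_nonneg _) (by positivity),
    ← sub_nonpos, ← sub_nonpos (b := (t * k) ^ 2)]
  have key : ‖((‖z‖ ^ 2 - k ^ 2 : ℝ) : ℂ) * v - t * conj z‖ ^ 2 - (t * k) ^ 2 =
      (‖z‖ ^ 2 - k ^ 2) * (‖(t : ℂ) - z * v‖ ^ 2 - (k * ‖v‖) ^ 2) := by
    have hz2 : ‖z‖ ^ 2 = z.re * z.re + z.im * z.im := by
      rw [← Complex.normSq_eq_norm_sq, Complex.normSq_apply]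
    generalize hq' : ‖z‖ ^ 2 - k ^ 2 = q
    rw [hz2] at hq'
    simp only [mul_pow, ← Complex.normSq_eq_norm_sq, Complex.normSq_apply]
    simp
    linear_combination (t ^ 2 - q * (v.re * v.re + v.im * v.im)) * hq'
  rw [key]
  constructor
  · intro h
    exact mul_nonpos_of_nonneg_of_nonpos hq.le h
  · intro h
    by_contra! h'
    exact absurd (mul_pos hq h') (not_lt.2 h)

-- Each 1/(z - w) lies in the same disc, and centres and radii add under summation.
open ComplexConjugate in
theorem norm_sum_inv_sub_le {z : ℂ} {k : ℝ} (hk : 0 ≤ k) (hz : k < ‖z‖) (s : Multiset ℂ)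
    (hs : ∀ w ∈ s, ‖w‖ ≤ k) :
    ‖((‖z‖ ^ 2 - k ^ 2 : ℝ) : ℂ) * (s.map fun w => 1 / (z - w)).sum -
      ((Multiset.card s : ℝ) : ℂ) * conj z‖ ≤ (Multiset.card s : ℝ) * k := by
  induction s using Multiset.induction_on with
  | empty => simp
  | cons w s ih =>
    have ih := ih fun x hx => hs x (Multiset.mem_cons_of_mem hx)
    have hw := hs w (Multiset.mem_cons_self w s)
    have hne : z - w ≠ 0 := sub_ne_zero.2 (by rintro rfl; linarith)
    have h1 := (norm_sub_mul_le_iff (v := 1 / (z - w)) hk zero_le_one hz).1 (by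
      have : ((1 : ℝ) : ℂ) - z * (1 / (z - w)) = -w * (1 / (z - w)) := by
        field_simp
        push_cast
        ring
      rw [this, norm_mul, norm_neg]
      gcongr)
    rw [Multiset.map_cons, Multiset.sum_cons, Multiset.card_cons]
    refine le_trans (le_of_eq ?_) ((norm_add_le _ _).trans ((add_le_add h1 ih).trans_eq ?_))
    · congr 1
      push_cast
      ring
    · push_cast
      ring

/-- If all zeros of `P` lie in `|w| ≤ k`, then so do those of `P'`, and `|nP - zP'| ≤ k |P'|`
outside that disc. -/
theorem norm_natDegree_mul_sub_le {P : Polynomial ℂ} {k : ℝ} (hk : 0 ≤ k)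
    (hzeros : ∀ z : ℂ, P.eval z = 0 → ‖z‖ ≤ k) {z : ℂ} (hz : k < ‖z‖) :
    ‖(P.natDegree : ℂ) * P.eval z - z * P.derivative.eval z‖ ≤ k * ‖P.derivative.eval z‖ ∧
      (P.natDegree ≠ 0 → P.derivative.eval z ≠ 0) := by
  have hP : P.eval z ≠ 0 := fun h => not_lt.2 (hzeros z h) hz
  have hsp := IsAlgClosed.splits P
  have hd := hsp.eval_derivative_eq_eval_mul_sum hP
  have hS := norm_sum_inv_sub_le hk hz P.roots
    fun w hw => hzeros w (Polynomial.isRoot_of_mem_roots hw)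
  rw [← hsp.natDegree_eq_card_roots] at hS
  set S := (P.roots.map fun w => 1 / (z - w)).sum
  have h1 := (norm_sub_mul_le_iff hk (Nat.cast_nonneg _) hz).2 hS
  rw [hd]
  constructor
  · calc ‖(P.natDegree : ℂ) * P.eval z - z * (P.eval z * S)‖
        = ‖P.eval z‖ * ‖(((P.natDegree : ℝ)) : ℂ) - z * S‖ := by
          rw [← norm_mul]
          congr 1
          push_cast
          ring
      _ ≤ ‖P.eval z‖ * (k * ‖S‖) := by gcongr
      _ = k * ‖P.eval z * S‖ := by rw [norm_mul]; ring
  · intro hn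
    -- `S = 0` would turn the disc bound into n|z| ≤ nk.
    refine mul_ne_zero hP fun h => ?_
    rw [h, mul_zero, zero_sub, norm_neg, norm_mul, Complex.norm_conj, Complex.norm_real,
      Real.norm_natCast] at hS
    have : (0 : ℝ) < P.natDegree := by exact_mod_cast Nat.pos_of_ne_zero hn
    nlinarith

/-! ### The gain from the minimum modulus. -/

open Metric in
/-- Minimum modulus principle for the reversed polynomial. -/
theorem le_norm_eval_reverse {P : Polynomial ℂ} {k m : ℝ} (hk : 0 < k) (hm0 : 0 < m)
    (hzeros : ∀ z : ℂ, P.eval z = 0 → ‖z‖ ≤ k) (hm : ∀ z : ℂ, ‖z‖ = k → m ≤ ‖P.eval z‖)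
    {ζ : ℂ} (hζ : ‖ζ‖ ≤ k⁻¹) : m / k ^ P.natDegree ≤ ‖P.reverse.eval ζ‖ := by
  have hP0 : P ≠ 0 := by
    rintro rfl
    have := hm k (by simp [hk.le])
    simp at this
    linarith
  have hev : ∀ w : ℂ, w ≠ 0 → P.reverse.eval w = w ^ P.natDegree * P.eval w⁻¹ :=
    fun w hw => Polynomial.eval_reflect le_rfl hw
  have hfr : ∀ w : ℂ, ‖w‖ = k⁻¹ → m / k ^ P.natDegree ≤ ‖P.reverse.eval w‖ := by
    intro w hw
    have hw0 : w ≠ 0 := norm_pos_iff.1 (hw ▸ inv_pos.2 hk)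
    rw [hev w hw0, norm_mul, norm_pow, hw, inv_pow, div_eq_inv_mul]
    gcongr
    exact hm _ (by rw [norm_inv, hw, inv_inv])
  have hne : ∀ w : ℂ, ‖w‖ ≤ k⁻¹ → P.reverse.eval w ≠ 0 := by
    intro w hw h
    rcases hw.lt_or_eq with hlt | heq
    · by_cases hw0 : w = 0
      · rw [hw0, ← Polynomial.coeff_zero_eq_eval_zero, Polynomial.coeff_zero_reverse] at h
        exact hP0 (Polynomial.leadingCoeff_eq_zero.1 h)
      · rw [hev w hw0] at h
        have h2 := hzeros _ ((mul_eq_zero.1 h).resolve_left (pow_ne_zero _ hw0))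
        rw [norm_inv] at h2
        exact absurd hlt (not_lt.2 ((inv_le_comm₀ hk (norm_pos_iff.2 hw0)).2 h2))
    · have := hfr w heq
      rw [h, norm_zero] at this
      exact absurd this (not_le.2 (by positivity))
  -- The maximum principle for the reciprocal carries the boundary bound inside.
  have hd : DiffContOnCl ℂ (fun w => (P.reverse.eval w)⁻¹) (ball 0 k⁻¹) := by
    refine P.reverse.differentiable.diffContOnCl.inv fun w hw => hne w ?_
    rw [closure_ball _ (by positivity)] at hw
    simpa using hw
  have h := Complex.norm_le_of_forall_mem_frontier_norm_le isBounded_ball hd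
    (C := (m / k ^ P.natDegree)⁻¹) (fun w hw => by
      rw [frontier_ball _ (by positivity), mem_sphere_zero_iff_norm] at hw
      rw [norm_inv]
      exact inv_anti₀ (by positivity) (hfr w hw))
    (z := ζ) (by rw [closure_ball _ (by positivity)]; simpa using hζ)
  rw [norm_inv] at h
  exact (inv_le_inv₀ (norm_pos_iff.2 (hne ζ hζ)) (by positivity)).1 h

open Filter Topology in
theorem norm_natDegree_mul_sub_add_le {P : Polynomial ℂ} {n : ℕ} (hn : P.natDegree = n)
    (hn0 : n ≠ 0) {k m : ℝ} (hk : 0 < k) (hm0 : 0 ≤ m)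
    (hzeros : ∀ z : ℂ, P.eval z = 0 → ‖z‖ ≤ k) (hm : ∀ z : ℂ, ‖z‖ = k → m ≤ ‖P.eval z‖)
    {z : ℂ} (hz : k < ‖z‖) :
    ‖(n : ℂ) * P.eval z - z * P.derivative.eval z‖ + k * (n * (m / k ^ n) * ‖z‖ ^ (n - 1)) ≤
      k * ‖P.derivative.eval z‖ := by
  rcases hm0.eq_or_lt with rfl | hm0
  · have := (norm_natDegree_mul_sub_le hk.le hzeros hz).1
    rw [hn] at this
    simpa using this
  set c := m / k ^ n
  have hc : 0 < c := by positivity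
  have hzpos : 0 < ‖z‖ := hk.trans hz
  have hz0 : z ≠ 0 := norm_pos_iff.1 hzpos
  have hnR : (0 : ℝ) < n := by exact_mod_cast Nat.pos_of_ne_zero hn0
  have hrev : ∀ ζ : ℂ, ‖ζ‖ ≤ k⁻¹ → c ≤ ‖P.reverse.eval ζ‖ := fun ζ hζ => by
    simpa only [hn] using le_norm_eval_reverse hk hm0 hzeros hm hζ
  have hF : ∀ l : ℂ, ‖l‖ < 1 →
      ‖(n : ℂ) * P.eval z - z * P.derivative.eval z‖ ≤
        k * ‖P.derivative.eval z + l * (n * c * z ^ (n - 1))‖ ∧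
      P.derivative.eval z + l * (n * c * z ^ (n - 1)) ≠ 0 := by
    intro l hl
    set F : Polynomial ℂ := P + Polynomial.C (l * c) * Polynomial.X ^ n with hFdef
    have hlc : ‖l * (c : ℂ)‖ < c := by
      rw [norm_mul, Complex.norm_real, Real.norm_of_nonneg hc.le]
      exact mul_lt_of_lt_one_left hc hl
    have hcoeff : F.coeff n ≠ 0 := by
      have h0 := hrev 0 (by simp [hk.le])
      rw [← Polynomial.coeff_zero_eq_eval_zero, Polynomial.coeff_zero_reverse,
        Polynomial.leadingCoeff, hn] at h0
      intro h
      have : P.coeff n = -(l * c) := by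
        have h' : P.coeff n + l * c = 0 := by
          rwa [hFdef, Polynomial.coeff_add, Polynomial.coeff_C_mul, Polynomial.coeff_X_pow_self,
            mul_one] at h
        linear_combination h'
      rw [this, norm_neg] at h0
      linarith
    have hdeg : F.natDegree = n := by
      refine le_antisymm ?_ (Polynomial.le_natDegree_of_ne_zero hcoeff)
      exact Polynomial.natDegree_add_le_of_degree_le hn.le (Polynomial.natDegree_C_mul_X_pow_le _ _)
    -- A zero with |w| > k would give |P(w)| = |l|c|w|^n < c|w|^n, against `hrev` at 1/w.
    have hFz : ∀ w : ℂ, F.eval w = 0 → ‖w‖ ≤ k := by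
      intro w hw
      by_contra! hwk
      have hw0 : w ≠ 0 := norm_pos_iff.1 (hk.trans hwk)
      have h1 := hrev w⁻¹ (by rw [norm_inv]; exact inv_anti₀ hk hwk.le)
      rw [Polynomial.reverse, Polynomial.eval_reflect le_rfl (inv_ne_zero hw0), inv_inv, hn,
        norm_mul, norm_pow, norm_inv, inv_pow, ← div_eq_inv_mul,
        le_div_iff₀ (pow_pos (norm_pos_iff.2 hw0) _)] at h1
      have h2 : P.eval w = -(l * c * w ^ n) := by
        have h' : P.eval w + l * c * w ^ n = 0 := by simpa [hFdef] using hw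
        linear_combination h'
      rw [h2, norm_neg, norm_mul, norm_pow] at h1
      have := le_of_mul_le_mul_right h1 (pow_pos (norm_pos_iff.2 hw0) _)
      linarith
    have hdF : F.derivative.eval z = P.derivative.eval z + l * (n * c * z ^ (n - 1)) := by
      simp [hFdef, Polynomial.derivative_X_pow]
      ring
    have hFe : F.eval z = P.eval z + l * c * z ^ n := by simp [hFdef]
    obtain ⟨h1, h2⟩ := norm_natDegree_mul_sub_le hk.le hFz hz
    rw [hdeg, hdF] at h1 h2
    refine ⟨?_, h2 hn0⟩
    convert h1 using 2
    rw [hFe]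
    obtain ⟨j, rfl⟩ := Nat.exists_eq_succ_of_ne_zero hn0
    simp
    ring
  set D := P.derivative.eval z
  have hD : D ≠ 0 := by simpa using (hF 0 (by simp)).2
  have hDpos : 0 < ‖D‖ := norm_pos_iff.2 hD
  set b : ℂ := n * c * z ^ (n - 1) with hb
  have hbn : ‖b‖ = n * c * ‖z‖ ^ (n - 1) := by
    rw [hb, norm_mul, norm_mul, norm_pow, Complex.norm_real, Real.norm_of_nonneg hc.le]
    simp
  have hbpos : 0 < ‖b‖ := by rw [hbn]; positivity
  have hb0 : b ≠ 0 := norm_pos_iff.1 hbpos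
  rw [← hbn]
  -- Otherwise l = -D/b is admissible and makes F'(z) = 0.
  have hbD : ‖b‖ ≤ ‖D‖ := by
    by_contra! h
    refine (hF (-D / b) ?_).2 ?_
    · rw [norm_div, norm_neg]
      exact (div_lt_one hbpos).2 h
    · field_simp
      ring
  have ht : ∀ t : ℝ, t ∈ Set.Ioo (0 : ℝ) 1 →
      ‖(n : ℂ) * P.eval z - z * D‖ ≤ k * (‖D‖ - t * ‖b‖) := by
    intro t ⟨ht0, ht1⟩
    -- This l points l·b against D: l·b = -t|b|D/|D|.
    have h := (hF (-(t * (D / ‖D‖) * (‖b‖ / b))) ?_).1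
    · refine h.trans_eq ?_
      congr 1
      have hDC : (‖D‖ : ℂ) ≠ 0 := by exact_mod_cast hDpos.ne'
      have e : D + -(t * (D / ‖D‖) * (‖b‖ / b)) * b = D * ((1 - t * ‖b‖ / ‖D‖ : ℝ) : ℂ) := by
        push_cast
        field_simp
        ring
      rw [e, norm_mul, Complex.norm_real, Real.norm_of_nonneg]
      · field_simp
      · rw [sub_nonneg, div_le_one hDpos]
        nlinarith
    · simp [abs_of_pos ht0, hDpos.ne', hbpos.ne']
      exact ht1
  have hlim : Tendsto (fun t : ℝ => k * (‖D‖ - t * ‖b‖)) (𝓝[<] 1) (𝓝 (k * (‖D‖ - 1 * ‖b‖))) :=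
    (Continuous.tendsto (by fun_prop) 1).mono_left nhdsWithin_le_nhds
  have := ge_of_tendsto hlim (by
    filter_upwards [Ioo_mem_nhdsLT (zero_lt_one' ℝ)] with t h using ht t h)
  linarith

section

open Filter Topology Complex Metric

/-- When k = |z| = 1 the strict hypothesis k < |z| fails, so the bound is used at tz with t > 1,
where |tz|^(n-1) ≥ 1 can be dropped, and then t → 1. -/
theorem norm_natDegree_mul_sub_add_le_of_one_le {P : Polynomial ℂ} {n : ℕ} (hn : P.natDegree = n)
    (hn0 : n ≠ 0) {k m : ℝ} (hk : 0 < k) (hk1 : k ≤ 1) (hm0 : 0 ≤ m)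
    (hzeros : ∀ z : ℂ, P.eval z = 0 → ‖z‖ ≤ k) (hm : ∀ z : ℂ, ‖z‖ = k → m ≤ ‖P.eval z‖)
    {z : ℂ} (hz : 1 ≤ ‖z‖) :
    ‖(n : ℂ) * P.eval z - z * P.derivative.eval z‖ + n * (m / k ^ (n - 1)) ≤
      k * ‖P.derivative.eval z‖ := by
  have hkey : ∀ t : ℝ, 1 < t →
      ‖(n : ℂ) * P.eval (t * z) - (t * z) * P.derivative.eval (t * z)‖ +
        n * (m / k ^ (n - 1)) ≤ k * ‖P.derivative.eval (t * z)‖ := by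
    intro t ht
    have h1 : 1 < ‖(t : ℂ) * z‖ := by
      rw [norm_mul, norm_real, Real.norm_of_nonneg (by linarith)]
      nlinarith
    refine le_trans (add_le_add_right ?_ _)
      (norm_natDegree_mul_sub_add_le hn hn0 hk hm0 hzeros hm (hk1.trans_lt h1))
    obtain ⟨j, rfl⟩ := Nat.exists_eq_succ_of_ne_zero hn0
    have h2 : k * (((j + 1 : ℕ) : ℝ) * (m / k ^ (j + 1)) * ‖(t : ℂ) * z‖ ^ j) =
        ((j + 1 : ℕ) : ℝ) * (m / k ^ j) * ‖(t : ℂ) * z‖ ^ j := by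
      rw [pow_succ]
      field_simp
    simp only [Nat.succ_eq_add_one, Nat.add_sub_cancel]
    rw [h2]
    exact le_mul_of_one_le_right (by positivity) (one_le_pow₀ h1.le)
  have hPc := P.continuous
  have hDc := P.derivative.continuous
  have hl : Tendsto (fun t : ℝ => ‖(n : ℂ) * P.eval (t * z) - (t * z) * P.derivative.eval (t * z)‖ +
        n * (m / k ^ (n - 1))) (𝓝[>] 1)
      (𝓝 (‖(n : ℂ) * P.eval ((1 : ℝ) * z) -
        ((1 : ℝ) * z) * P.derivative.eval ((1 : ℝ) * z)‖ + n * (m / k ^ (n - 1)))) :=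
    (Continuous.tendsto (by fun_prop) 1).mono_left nhdsWithin_le_nhds
  have hr : Tendsto (fun t : ℝ => k * ‖P.derivative.eval (t * z)‖) (𝓝[>] 1)
      (𝓝 (k * ‖P.derivative.eval ((1 : ℝ) * z)‖)) :=
    (Continuous.tendsto (by fun_prop) 1).mono_left nhdsWithin_le_nhds
  have := le_of_tendsto_of_tendsto hl hr
    (by filter_upwards [self_mem_nhdsWithin] with t h using hkey t h)
  simpa using this

/-! ### The polar derivative and the passage to p-th means. -/

/-- A lower bound for the polar derivative on the unit circle. -/
theorem mul_norm_derivative_le_maxModulus_polarDeriv {P : Polynomial ℂ} {n : ℕ}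
    (hn : P.natDegree = n) {k μ : ℝ} {α z : ℂ} (hz : ‖z‖ = 1)
    (h : ‖(n : ℂ) * P.eval z - z * P.derivative.eval z‖ + n * μ ≤ k * ‖P.derivative.eval z‖) :
    (‖α‖ - k) * ‖P.derivative.eval z‖ ≤ maxModulus (polarDeriv α P) 1 - n * μ := by
  have h1 : ‖(polarDeriv α P).eval z‖ ≤ maxModulus (polarDeriv α P) 1 :=
    (isGreatest_maxModulus _ zero_le_one).2 ⟨z, by simpa using hz, rfl⟩
  have h2 : (polarDeriv α P).eval z =
      α * P.derivative.eval z + ((n : ℂ) * P.eval z - z * P.derivative.eval z) := by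
    simp [polarDeriv, hn]
    ring
  have h3 := norm_sub_le ((polarDeriv α P).eval z)
    ((n : ℂ) * P.eval z - z * P.derivative.eval z)
  have h4 : (polarDeriv α P).eval z - ((n : ℂ) * P.eval z - z * P.derivative.eval z) =
      α * P.derivative.eval z := by rw [h2]; ring
  rw [h4, norm_mul] at h3
  linarith

theorem continuous_integral_rpow_norm {f : ℂ → ℂ} (hf : Continuous f) {p : ℝ} (hp : 0 < p) :
    Continuous fun r : ℝ => ∫ θ in (0 : ℝ)..(2 * Real.pi), ‖f (r * exp (θ * I))‖ ^ p := by
  refine intervalIntegral.continuous_parametric_intervalIntegral_of_continuous' ?_ _ _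
  refine Continuous.rpow_const ?_ fun _ => Or.inr hp.le
  fun_prop

/-- The subordination estimate for `G = (B + z E) / n` when `z E / B` is dominated by `k`. -/
theorem integral_rpow_norm_le_of_dominated {B E G : Polynomial ℂ} {a k X p : ℝ} (ha : 0 ≤ a)
    (hk : 0 < k) (hk1 : k ≤ 1) (hp : 0 < p) (hB0 : ∀ z : ℂ, ‖z‖ < 1 → B.eval z ≠ 0)
    (hBX : ∀ z : ℂ, ‖z‖ = 1 → a * ‖B.eval z‖ ≤ X)
    (hE : ∀ z : ℂ, z ≠ 0 → ‖z‖ ≤ 1 → ‖E.eval z‖ ≤ k * ‖B.eval z‖)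
    (hG : ∀ z : ℂ, z ≠ 0 → G.eval z = B.eval z + z * E.eval z) :
    a ^ p * ∫ θ in (0 : ℝ)..(2 * Real.pi), ‖G.eval (exp (θ * I))‖ ^ p ≤
      X ^ p * ∫ θ in (0 : ℝ)..(2 * Real.pi), ‖1 + k * exp (θ * I)‖ ^ p := by
  have hX0 : 0 ≤ X := (mul_nonneg ha (norm_nonneg (B.eval 1))).trans (hBX 1 (by simp))
  have hBX' : ∀ z : ℂ, ‖z‖ ≤ 1 → a * ‖B.eval z‖ ≤ X := by
    intro z hz
    have h := Complex.norm_le_of_forall_mem_frontier_norm_le (U := ball 0 1) (C := X)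
      (f := fun z => (a : ℂ) * B.eval z) isBounded_ball
      ((B.differentiable.const_mul _).diffContOnCl) (fun w hw => by
        rw [frontier_ball _ one_ne_zero, mem_sphere_zero_iff_norm] at hw
        simpa [abs_of_nonneg ha] using hBX w hw)
      (z := z) (by rw [closure_ball _ one_ne_zero]; simpa using hz)
    simpa [abs_of_nonneg ha] using h
  -- B may vanish on the unit circle; a radius r < 1 keeps E/B regular on the closed disc and makes
  -- kr < 1 even when k = 1.
  have hr : ∀ r : ℝ, r ∈ Set.Ioo (0 : ℝ) 1 →
      a ^ p * ∫ θ in (0 : ℝ)..(2 * Real.pi), ‖G.eval (r * exp (θ * I))‖ ^ p ≤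
        X ^ p * ∫ θ in (0 : ℝ)..(2 * Real.pi), ‖1 + k * (r * exp (θ * I))‖ ^ p := by
    rintro r ⟨hr0, hr1⟩
    have hrz : ∀ z : ℂ, ‖z‖ ≤ 1 → ‖(r : ℂ) * z‖ < 1 := by
      intro z hz
      rw [norm_mul, norm_real, Real.norm_of_nonneg hr0.le]
      nlinarith [norm_nonneg z]
    have hkC : (k : ℂ) ≠ 0 := by exact_mod_cast hk.ne'
    have hrC : (r : ℂ) ≠ 0 := by exact_mod_cast hr0.ne'
    set ψ : ℂ → ℂ := fun z => (k : ℂ)⁻¹ * (E.eval (r * z) / B.eval (r * z)) with hψdef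
    have hψ : DiffContOnCl ℂ ψ (ball 0 1) := by
      refine DifferentiableOn.diffContOnCl ?_
      rw [closure_ball _ one_ne_zero]
      intro z hz
      have hz' : ‖z‖ ≤ 1 := by simpa using hz
      have hEd : Differentiable ℂ (fun z : ℂ => E.eval (r * z)) :=
        E.differentiable.comp (by fun_prop)
      have hBd : Differentiable ℂ (fun z : ℂ => B.eval (r * z)) :=
        B.differentiable.comp (by fun_prop)
      exact (((hEd z).div (hBd z) (hB0 _ (hrz z hz'))).const_mul _).differentiableWithinAt
    have hψb : ∀ z, ‖z‖ = 1 → ‖ψ z‖ ≤ 1 := by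
      intro z hz
      have hz0 : z ≠ 0 := norm_pos_iff.1 (hz ▸ one_pos)
      have hlt := hrz z hz.le
      have hB := norm_pos_iff.2 (hB0 _ hlt)
      have h := hE _ (mul_ne_zero hrC hz0) hlt.le
      rw [hψdef, norm_mul, norm_inv, norm_div, norm_real, Real.norm_of_nonneg hk.le,
        ← div_eq_inv_mul, div_div, div_le_one (by positivity)]
      linarith
    have hsub := integral_rpow_norm_one_add_le hψ hψb (s := k * r) (by positivity)
      (by nlinarith) hp
    have hψc := continuous_comp_exp hψ.continuousOn_closedUnitBall
    have he : Continuous fun θ : ℝ => exp (θ * I) := by fun_prop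
    have hGc := G.continuous
    calc a ^ p * ∫ θ in (0 : ℝ)..(2 * Real.pi), ‖G.eval (r * exp (θ * I))‖ ^ p
        ≤ X ^ p * ∫ θ in (0 : ℝ)..(2 * Real.pi),
            ‖1 + ((k * r : ℝ) : ℂ) * (exp (θ * I) * ψ (exp (θ * I)))‖ ^ p := by
          rw [← intervalIntegral.integral_const_mul, ← intervalIntegral.integral_const_mul]
          refine intervalIntegral.integral_mono_on Real.two_pi_pos.le
            (Continuous.intervalIntegrable ?_ _ _) (Continuous.intervalIntegrable ?_ _ _) ?_
          · exact continuous_const.mul (Continuous.rpow_const (by fun_prop) fun _ => Or.inr hp.le)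
          · exact continuous_const.mul (Continuous.rpow_const
              (continuous_const.add (continuous_const.mul (he.mul hψc))).norm fun _ => Or.inr hp.le)
          intro θ _
          have hn1 : ‖exp (θ * I)‖ = 1 := norm_exp_ofReal_mul_I θ
          have hlt := hrz _ hn1.le
          have hB := hB0 _ hlt
          rw [← Real.mul_rpow ha (norm_nonneg _), ← Real.mul_rpow hX0 (norm_nonneg _)]
          have hGe : G.eval (r * exp (θ * I)) = B.eval (r * exp (θ * I)) *
              (1 + ((k * r : ℝ) : ℂ) * (exp (θ * I) * ψ (exp (θ * I)))) := by
            rw [hG _ (mul_ne_zero hrC (exp_ne_zero _)), hψdef]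
            push_cast
            field_simp
          rw [hGe, norm_mul, ← mul_assoc]
          gcongr
          exact hBX' _ hlt.le
      _ ≤ X ^ p * ∫ θ in (0 : ℝ)..(2 * Real.pi), ‖1 + ((k * r : ℝ) : ℂ) * exp (θ * I)‖ ^ p := by
          gcongr
      _ = _ := by
          push_cast
          simp only [mul_assoc]
  have hl : Tendsto (fun r : ℝ => a ^ p * ∫ θ in (0 : ℝ)..(2 * Real.pi),
      ‖G.eval (r * exp (θ * I))‖ ^ p) (𝓝[<] 1) (𝓝 (a ^ p * ∫ θ in (0 : ℝ)..(2 * Real.pi),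
      ‖G.eval ((1 : ℝ) * exp (θ * I))‖ ^ p)) :=
    ((continuous_const.mul (continuous_integral_rpow_norm G.continuous hp)).tendsto 1).mono_left
      nhdsWithin_le_nhds
  have hrr : Tendsto (fun r : ℝ => X ^ p * ∫ θ in (0 : ℝ)..(2 * Real.pi),
      ‖1 + k * (r * exp (θ * I))‖ ^ p) (𝓝[<] 1) (𝓝 (X ^ p * ∫ θ in (0 : ℝ)..(2 * Real.pi),
      ‖1 + k * ((1 : ℝ) * exp (θ * I))‖ ^ p)) :=
    ((continuous_const.mul (continuous_integral_rpow_norm (f := fun z => 1 + k * z)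
      (by fun_prop) hp)).tendsto 1).mono_left nhdsWithin_le_nhds
  have := le_of_tendsto_of_tendsto hl hrr (by
    filter_upwards [Ioo_mem_nhdsLT (zero_lt_one' ℝ)] with r h using hr r h)
  simpa using this

theorem integral_comp_exp_inv (f : ℂ → ℝ) :
    ∫ θ in (0 : ℝ)..(2 * Real.pi), f (exp (θ * I))⁻¹ =
      ∫ θ in (0 : ℝ)..(2 * Real.pi), f (exp (θ * I)) := by
  have h := intervalIntegral.integral_comp_sub_left (a := 0) (b := 2 * Real.pi)
    (fun θ : ℝ => f (exp (θ * I))) (2 * Real.pi)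
  rw [sub_self, sub_zero] at h
  rw [← h]
  refine intervalIntegral.integral_congr fun θ _ => ?_
  congr 1
  rw [← exp_neg, exp_eq_exp_iff_exists_int]
  exact ⟨-1, by push_cast; ring⟩

theorem integral_rpow_norm_add_const_le {P : Polynomial ℂ} {n : ℕ} (hn : P.natDegree = n)
    (hn0 : n ≠ 0) {k m X p : ℝ} {α c : ℂ} (hk : 0 < k) (hk1 : k ≤ 1) (hm0 : 0 ≤ m)
    (hzeros : ∀ z : ℂ, P.eval z = 0 → ‖z‖ ≤ k) (hm : ∀ z : ℂ, ‖z‖ = k → m ≤ ‖P.eval z‖)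
    (hα : k ≤ ‖α‖) (hc : ‖c‖ ≤ m / k ^ (n - 1)) (hp : 0 < p)
    (hX : ∀ z : ℂ, ‖z‖ = 1 → (‖α‖ - k) * ‖P.derivative.eval z‖ ≤ X) :
    (n * (‖α‖ - k)) ^ p * ∫ θ in (0 : ℝ)..(2 * Real.pi), ‖P.eval (exp (θ * I)) + c‖ ^ p ≤
      X ^ p * ∫ θ in (0 : ℝ)..(2 * Real.pi), ‖1 + k * exp (θ * I)‖ ^ p := by
  have hdP : P.derivative.natDegree ≤ n - 1 := hn ▸ Polynomial.natDegree_derivative_le P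
  set A : Polynomial ℂ := Polynomial.C (n : ℂ) * P - Polynomial.X * Polynomial.derivative P +
    Polynomial.C (n * c) with hA
  have hAe : ∀ z, A.eval z = (n : ℂ) * P.eval z - z * P.derivative.eval z + n * c := by
    intro z; simp [hA]
  have hAdeg : A.natDegree ≤ n - 1 := by
    -- The z^n terms of nP and zP' cancel, and the added constant only touches the coefficient of
    -- index 0.
    rw [Polynomial.natDegree_le_iff_coeff_eq_zero]
    intro j hj
    obtain ⟨i, rfl⟩ := Nat.exists_eq_succ_of_ne_zero (by omega : j ≠ 0)
    rw [hA, Polynomial.coeff_add, Polynomial.coeff_sub, Polynomial.coeff_C_mul,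
      Polynomial.coeff_X_mul, Polynomial.coeff_derivative, Polynomial.coeff_C_succ]
    rcases (by omega : n = i + 1 ∨ n < i + 1) with h | h
    · rw [h]; push_cast; ring
    · rw [Polynomial.coeff_eq_zero_of_natDegree_lt (by omega)]; ring
  have hR : ∀ z : ℂ, z ≠ 0 → ((P + Polynomial.C c).reflect n).eval z =
      z ^ n * (P.eval z⁻¹ + c) := by
    intro z hz
    rw [Polynomial.eval_reflect (by rw [Polynomial.natDegree_add_C, hn]) hz]
    simp
  have hinv : ∀ z : ℂ, z ≠ 0 → ‖z‖ ≤ 1 → 1 ≤ ‖z⁻¹‖ := by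
    intro z hz h
    rw [norm_inv]
    exact (one_le_inv₀ (norm_pos_iff.2 hz)).2 h
  have key := integral_rpow_norm_le_of_dominated (B := P.derivative.reflect (n - 1))
    (E := A.reflect (n - 1)) (G := Polynomial.C (n : ℂ) * (P + Polynomial.C c).reflect n)
    (a := ‖α‖ - k) (X := X) (k := k) (p := p) (sub_nonneg.2 hα) hk hk1 hp ?_ ?_ ?_ ?_
  · have hI : ∫ θ in (0 : ℝ)..(2 * Real.pi),
        ‖(Polynomial.C (n : ℂ) * (P + Polynomial.C c).reflect n).eval (exp (θ * I))‖ ^ p =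
        (n : ℝ) ^ p * ∫ θ in (0 : ℝ)..(2 * Real.pi), ‖P.eval (exp (θ * I)) + c‖ ^ p := by
      rw [← integral_comp_exp_inv fun z => ‖P.eval z + c‖ ^ p,
        ← intervalIntegral.integral_const_mul]
      refine intervalIntegral.integral_congr fun θ _ => ?_
      rw [Polynomial.eval_mul, Polynomial.eval_C, hR _ (exp_ne_zero _), norm_mul, norm_mul,
        norm_pow, norm_exp_ofReal_mul_I, one_pow, one_mul,
        Real.mul_rpow (norm_nonneg _) (norm_nonneg _), norm_natCast]
    rw [hI, ← mul_assoc, ← Real.mul_rpow (sub_nonneg.2 hα) (Nat.cast_nonneg n)] at key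
    rwa [mul_comm (n : ℝ)]
  · intro z hz
    by_cases hz0 : z = 0
    -- At 0 the reflected derivative takes the value n times the leading coefficient of P.
    · rw [hz0, ← Polynomial.coeff_zero_eq_eval_zero, Polynomial.coeff_reflect,
        Polynomial.revAt_le (Nat.zero_le _), Nat.sub_zero, Polynomial.coeff_derivative,
        Nat.sub_add_cancel (Nat.one_le_iff_ne_zero.2 hn0)]
      refine mul_ne_zero ?_ (Nat.cast_add_one_ne_zero _)
      rw [← hn, Polynomial.coeff_natDegree, Ne, Polynomial.leadingCoeff_eq_zero]
      rintro rfl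
      exact hn0 (by simpa using hn.symm)
    · rw [Polynomial.eval_reflect hdP hz0]
      refine mul_ne_zero (pow_ne_zero _ hz0)
        ((norm_natDegree_mul_sub_le hk.le hzeros ?_).2 (hn ▸ hn0))
      rw [norm_inv]
      exact hk1.trans_lt ((one_lt_inv₀ (norm_pos_iff.2 hz0)).2 hz)
  · intro z hz
    rw [Polynomial.eval_reflect hdP (norm_pos_iff.1 (hz ▸ one_pos)), norm_mul, norm_pow, hz,
      one_pow, one_mul]
    exact hX _ (by rw [norm_inv, hz, inv_one])
  · intro z hz0 hz
    rw [Polynomial.eval_reflect hdP hz0, Polynomial.eval_reflect hAdeg hz0, norm_mul, norm_mul,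
      mul_left_comm]
    gcongr
    rw [hAe]
    refine le_trans ?_ (norm_natDegree_mul_sub_add_le_of_one_le hn hn0 hk hk1 hm0 hzeros hm
      (hinv z hz0 hz))
    refine (norm_add_le _ _).trans ?_
    gcongr
    rw [norm_mul, Complex.norm_natCast]
    gcongr
  · intro z hz0
    rw [Polynomial.eval_reflect hdP hz0, Polynomial.eval_reflect hAdeg hz0, Polynomial.eval_mul,
      Polynomial.eval_C, hR z hz0, hAe]
    obtain ⟨j, rfl⟩ := Nat.exists_eq_succ_of_ne_zero hn0
    simp only [Nat.succ_eq_add_one, Nat.add_sub_cancel]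
    field_simp
    ring

end

/-! ### Assembly. -/

open Complex in
theorem corollary1 (n : ℕ) (P : Polynomial ℂ) (hdeg : P.degree = (n : WithBot ℕ))
    (k : ℝ) (hk0 : 0 < k) (hk1 : k ≤ 1)
    (hzeros : ∀ z : ℂ, P.eval z = 0 → ‖z‖ ≤ k)
    (α β : ℂ) (hα : k ≤ ‖α‖) (hβ : ‖β‖ ≤ 1)
    (p : ℝ) (hp : 0 < p) :
    (n : ℝ) * (‖α‖ - k) *
        circleLpNorm p
          (fun z => P.eval z + (minModulus P k : ℂ) * β / (k : ℂ) ^ ((n : ℤ) - 1)) ≤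
      circleLpNorm p (fun z => 1 + (k : ℂ) * z) *
        (maxModulus (polarDeriv α P) 1 -
          (n : ℝ) * minModulus P k / k ^ ((n : ℤ) - 1)) := by
  have hn : P.natDegree = n := Polynomial.natDegree_eq_of_degree_eq_some hdeg
  have hnn : ∀ f : ℂ → ℂ, 0 ≤ ∫ θ in (0 : ℝ)..(2 * Real.pi), ‖f (exp (θ * I))‖ ^ p := fun f =>
    intervalIntegral.integral_nonneg Real.two_pi_pos.le fun θ _ => by positivity
  -- For n = 0 the exponent n - 1 is -1, but the factor n removes the left side and the term in m.
  rcases eq_or_ne n 0 with rfl | hn0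
  · have h1 : 0 ≤ maxModulus (polarDeriv α P) 1 :=
      (norm_nonneg _).trans ((isGreatest_maxModulus (polarDeriv α P) zero_le_one).2
        ⟨1, by simp, rfl⟩)
    have h2 : 0 ≤ circleLpNorm p (fun z => 1 + (k : ℂ) * z) :=
      Real.rpow_nonneg (hnn fun z => 1 + (k : ℂ) * z) _
    simpa using mul_nonneg h2 h1
  have hmin := isLeast_minModulus P hk0.le
  have hm0 : 0 ≤ minModulus P k := by
    obtain ⟨w, -, hw⟩ := hmin.1
    exact hw ▸ norm_nonneg _
  have hm : ∀ z : ℂ, ‖z‖ = k → minModulus P k ≤ ‖P.eval z‖ := fun z hz =>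
    hmin.2 ⟨z, by simpa using hz, rfl⟩
  have hz : (n : ℤ) - 1 = ((n - 1 : ℕ) : ℤ) := by omega
  rw [hz, zpow_natCast, zpow_natCast, mul_div_assoc (n : ℝ)]
  have hX : ∀ z : ℂ, ‖z‖ = 1 → (‖α‖ - k) * ‖P.derivative.eval z‖ ≤
      maxModulus (polarDeriv α P) 1 - n * (minModulus P k / k ^ (n - 1)) := fun z hz =>
    mul_norm_derivative_le_maxModulus_polarDeriv hn hz
      (norm_natDegree_mul_sub_add_le_of_one_le hn hn0 hk0 hk1 hm0 hzeros hm hz.ge)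
  have hc : ‖(minModulus P k : ℂ) * β / (k : ℂ) ^ (n - 1)‖ ≤ minModulus P k / k ^ (n - 1) := by
    rw [norm_div, norm_mul, norm_pow, norm_real, norm_real, Real.norm_of_nonneg hm0,
      Real.norm_of_nonneg hk0.le]
    gcongr
    exact mul_le_of_le_one_right hm0 hβ
  have hX0 : 0 ≤ maxModulus (polarDeriv α P) 1 - n * (minModulus P k / k ^ (n - 1)) :=
    (mul_nonneg (sub_nonneg.2 hα) (norm_nonneg (P.derivative.eval 1))).trans (hX 1 norm_one)
  have hA0 : 0 ≤ (n : ℝ) * (‖α‖ - k) := mul_nonneg (Nat.cast_nonneg n) (sub_nonneg.2 hα)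
  have key := integral_rpow_norm_add_const_le hn hn0 hk0 hk1 hm0 hzeros hm hα hc hp hX
  have key2 := Real.rpow_le_rpow (mul_nonneg (Real.rpow_nonneg hA0 p)
    (hnn fun z => P.eval z + (minModulus P k : ℂ) * β / (k : ℂ) ^ (n - 1))) key
    (by positivity : 0 ≤ 1 / p)
  rw [Real.mul_rpow (Real.rpow_nonneg hA0 p)
      (hnn fun z => P.eval z + (minModulus P k : ℂ) * β / (k : ℂ) ^ (n - 1)),
    Real.mul_rpow (Real.rpow_nonneg hX0 p) (hnn fun z => 1 + k * z), ← Real.rpow_mul hA0,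
    ← Real.rpow_mul hX0, mul_one_div_cancel hp.ne', Real.rpow_one, Real.rpow_one] at key2
  rw [mul_comm (circleLpNorm p fun z => 1 + (k : ℂ) * z)]
  exact key2
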